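/- **The AMPC model.** Let $\Delta\subseteq\{0,1\}^N$ and $g:\Delta\to\{0,1\}$. A deterministic AMPC algorithm with I/O capacity $S$ and $R$ rounds has finitely many (arbitrarily many) computationally unbounded machines and stores $\mathcal D_0,\dots,\mathcal D_R$, each a multiset of key–value pairs. On input $x\in\{0,1\}^N$, $\mathcal D_0$ consists of the pairs $(i,x_i)$. In round $r$ each machine adaptively queries keys of $\mathcal D_{r-1}$ (the response to a query is the whole, possibly empty, multiset of values under that key) and then writes key–value pairs, depending only on the responses, to $\mathcal D_r$. On inputs $x\in\Delta$, in each round, for each machine the total number of values in its responses plus the number of its empty responses is at most $S$, and it writes at most $S$ pairs. On inputs $x\notin\Delta$ a machine that exceeds the reading bound stops and writes nothing. On every input in $\{0,1\}^N$, at most $S$ values are written under any single key in any round. The algorithm outputs $b$ on $x$ if $\mathcal D_R$ consists of the single pair $(\textsc{answer},b)$; it computes $g$ if it outputs $g(x)$ on every $x\in\Delta$. A randomized AMPC algorithm is a (discrete) probability distribution over deterministic ones; it has error at most $\eta$ if on each $x\in\Delta$ it outputs $g(x)$ with probability at least $1-\eta$, and its number of rounds is the maximum over its support. **The problem.** For $k\ge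 2$ dividing $n$, the $1\text{v}k$-Cycle problem is the partial Boolean function on $N=\binom n2$ bits, one for each potential edge of a graph on $n$ labelled vertices, that is defined on the graphs that are a cycle of length $n$ (value $1$) or a disjoint union of $k$ cycles of length $n/k$ (value $0$). **Theorem.** Let $\delta\in(0,1)$. There is a constant $c=c(\delta)>0$ such that for every $C$ there is $n_0=n_0(\delta,C)$ with the following property. Let $n\ge n_0$, let $k\ge2$ divide $n$ with $k\le C n^{\delta}$, let $\varepsilon>0$, and let $S$ be a nonnegative integer with $S\le n^{\varepsilon}$. Then every deterministic AMPC algorithm with I/O capacity $S$ that computes $1\text{v}k$-Cycle on $n$ vertices, and every randomized AMPC algorithm with I/O capacity $S$ that computes it with error at most $1/6$, uses at least $c/\varepsilon$ rounds. That is, for $k=O(n^\delta)$ and $S=n^\varepsilon$, $\Omega(1/\varepsilon)$ rounds are required. -/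

import Mathlib

/-! ### The AMPC model -/

/-- Keys of the distributed data store of an algorithm whose input bits are indexed by `I`:
one key for each input bit, the key `answer`, and arbitrary further keys. -/
inductive DDSKey (I K : Type) : Type
  | input (i : I)
  | answer
  | other (a : K)

/-- Values of the distributed data store: bits and arbitrary further words. -/
inductive DDSValue (V : Type) : Type
  | bit (b : Bool)
  | other (v : V)

/-- The content of a distributed data store: a multiset of key-value pairs. -/
abbrev DDS (I K V : Type) : Type := Multiset (DDSKey I K × DDSValue V)

open Classical in
/-- The response to a query: the multiset of all values stored under the key (possibly empty). -/
noncomputable def DDS.lookup {I K V : Type} (D : DDS I K V) (a : DDSKey I K) :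
    Multiset (DDSValue V) :=
  (D.filter (fun p => p.1 = a)).map Prod.snd

/-- The initial store: one pair `(i, x i)` for each input bit. -/
def DDS.ofInput {I : Type} [Fintype I] (K V : Type) (x : I → Bool) : DDS I K V :=
  (Finset.univ : Finset I).val.map (fun i => (DDSKey.input i, DDSValue.bit (x i)))

/-- What a (computationally unbounded) machine does in one round: a decision tree, which either
queries a key and continues depending on the response, or stops and writes key-value pairs. -/
inductive MachineProgram (I K V : Type) : Type
  | write (out : Multiset (DDSKey I K × DDSValue V))
  | query (a : DDSKey I K) (next : Multiset (DDSValue V) → MachineProgram I K V)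

/-- The cost of a response: its number of values, and `1` if it is empty. -/
def responseCost {V : Type} (W : Multiset (DDSValue V)) : ℕ := max 1 (Multiset.card W)

/-- The pairs written by a machine that reads the store `D` and may still receive responses of
total cost `c`. A machine that exceeds this stops and writes nothing. -/
noncomputable def MachineProgram.run {I K V : Type} (D : DDS I K V) :
    ℕ → MachineProgram I K V → Multiset (DDSKey I K × DDSValue V)
  | _, .write out => out
  | c, .query a next =>
      if responseCost (D.lookup a) ≤ c then
        MachineProgram.run D (c - responseCost (D.lookup a)) (next (D.lookup a))
      else 0

/-- On the store `D`, the machine receives responses of total cost at most `c` and writes at most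
`S` key-value pairs. -/
def MachineProgram.RespectsCapacity {I K V : Type} (D : DDS I K V) (S : ℕ) :
    ℕ → MachineProgram I K V → Prop
  | _, .write out => Multiset.card out ≤ S
  | c, .query a next =>
      responseCost (D.lookup a) ≤ c ∧
        MachineProgram.RespectsCapacity D S (c - responseCost (D.lookup a)) (next (D.lookup a))

/-- The data of a deterministic AMPC algorithm on input bits indexed by `I`: a number of rounds, a
finite number of machines, and what each machine does in each round (`program r v` is what
machine `v` does in round `r + 1`). -/
structure AMPCProtocol (I : Type) : Type 1 where
  K : Type
  V : Type
  rounds : ℕ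
  machines : ℕ
  program : ℕ → Fin machines → MachineProgram I K V

/-- The store after `r` rounds of the computation on the input `x` with I/O capacity `S`. -/
noncomputable def AMPCProtocol.dds {I : Type} [Fintype I] (A : AMPCProtocol I) (S : ℕ)
    (x : I → Bool) : ℕ → DDS I A.K A.V
  | 0 => DDS.ofInput A.K A.V x
  | r + 1 => ∑ v : Fin A.machines, (A.program r v).run (A.dds S x r) S

/-- A deterministic AMPC algorithm with I/O capacity `S` for inputs in `Δ`. Every machine
respects the capacity in every round on every valid input. On every input, valid or not, at most
`S` values are written under any single key in any round. -/
structure AMPCAlgorithm (I : Type) [Fintype I] (Δ : Set (I → Bool)) (S : ℕ) : Type 1 extends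
    AMPCProtocol I where
  respectsCapacity : ∀ x ∈ Δ, ∀ r < rounds, ∀ v : Fin machines,
    (program r v).RespectsCapacity (toAMPCProtocol.dds S x r) S S
  card_lookup_le : ∀ x : I → Bool, ∀ r < rounds, ∀ a : DDSKey I K,
    Multiset.card ((toAMPCProtocol.dds S x (r + 1)).lookup a) ≤ S

/-- On the input `x`, the final store consists of the single pair `(answer, b)`. -/
def AMPCAlgorithm.Outputs {I : Type} [Fintype I] {Δ : Set (I → Bool)} {S : ℕ}
    (A : AMPCAlgorithm I Δ S) (x : I → Bool) (b : Bool) : Prop :=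
  A.dds S x A.rounds = {(DDSKey.answer, DDSValue.bit b)}

/-- The deterministic algorithm `A` computes the partial Boolean function `g`. -/
def AMPCAlgorithm.Computes {I : Type} [Fintype I] {Δ : Set (I → Bool)} {S : ℕ}
    (A : AMPCAlgorithm I Δ S) (g : Δ → Bool) : Prop :=
  ∀ x : Δ, A.Outputs x (g x)

/-- A randomized AMPC algorithm: a probability distribution over deterministic ones. -/
abbrev RandomizedAMPCAlgorithm (I : Type) [Fintype I] (Δ : Set (I → Bool)) (S : ℕ) : Type 1 :=
  PMF (AMPCAlgorithm I Δ S)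

/-- The randomized algorithm `P` computes the partial Boolean function `g` with error at most
`η`: on each valid input it outputs the value of `g` with probability at least `1 - η`. -/
def RandomizedAMPCAlgorithm.ComputesWithError {I : Type} [Fintype I] {Δ : Set (I → Bool)} {S : ℕ}
    (P : RandomizedAMPCAlgorithm I Δ S) (g : Δ → Bool) (η : ℝ) : Prop :=
  ∀ x : Δ, ENNReal.ofReal (1 - η) ≤ P.toOuterMeasure {A | A.Outputs x (g x)}

/-- The randomized algorithm `P` uses at most `R` rounds: each deterministic algorithm in its
support does. -/
def RandomizedAMPCAlgorithm.RoundsAtMost {I : Type} [Fintype I] {Δ : Set (I → Bool)} {S : ℕ}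
    (P : RandomizedAMPCAlgorithm I Δ S) (R : ℕ) : Prop :=
  ∀ A ∈ P.support, A.rounds ≤ R

/-! ### The problem of distinguishing one cycle from `k` cycles -/

/-- The `n.choose 2` potential edges of a graph on the vertex set `Fin n`. -/
abbrev PotentialEdge (n : ℕ) : Type := {e : Sym2 (Fin n) // ¬ e.IsDiag}

/-- The graph on `n` vertices that is encoded by one bit for each potential edge. -/
def graphOfBits {n : ℕ} (x : PotentialEdge n → Bool) : SimpleGraph (Fin n) :=
  SimpleGraph.fromEdgeSet {e | ∃ h : ¬ e.IsDiag, x ⟨e, h⟩ = true}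

/-- The disjoint union of `k` cycles of length `m` (meaningful for `3 ≤ m`). -/
def disjointCycles (k m : ℕ) : SimpleGraph (Fin k × Fin m) where
  Adj u v := u.1 = v.1 ∧ (SimpleGraph.cycleGraph m).Adj u.2 v.2
  symm := ⟨fun _ _ h => ⟨h.1.symm, h.2.symm⟩⟩
  loopless := ⟨fun _ h => h.2.ne rfl⟩

/-- The encoded graph is a cycle of length `n`. -/
def IsOneCycle {n : ℕ} (x : PotentialEdge n → Bool) : Prop :=
  Nonempty (graphOfBits x ≃g SimpleGraph.cycleGraph n)

/-- The encoded graph is the disjoint union of `k` cycles of length `n / k`. -/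
def IsKCycles {n : ℕ} (k : ℕ) (x : PotentialEdge n → Bool) : Prop :=
  Nonempty (graphOfBits x ≃g disjointCycles k (n / k))

/-- The valid inputs: one cycle of length `n`, or `k` disjoint cycles of length `n / k`. -/
def oneVsKCycleDomain (n k : ℕ) : Set (PotentialEdge n → Bool) :=
  {x | IsOneCycle x ∨ IsKCycles k x}

open Classical in
/-- The partial Boolean function with value `1` on a cycle of length `n` and value `0` on `k`
disjoint cycles of length `n / k`. -/
noncomputable def oneVsKCycle (n k : ℕ) : oneVsKCycleDomain n k → Bool :=
  fun x => decide (IsOneCycle x.1)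

/-! The proof is the polynomial method. Any 0/1 test on the response to one query is a polynomial in
the input bits whose degree grows by a factor of at most `S * S` per round: a machine multiplies at
most `S` response indicators, and at most `S` machines contribute values under one key
(`AMPCAlgorithm.apply_lookup_mem_cubeDegreeLE`). So after `R` rounds acceptance has degree at most
about `S ^ (2 * R)`.

A function with values in [0, 1] on the cube and degree `d` satisfies `∑ i, (f (e_i) - f 0) ≤ d ^ 2`
(`sum_singleBit_sub_le`): the sum is the derivative at `p = 0` of the expectation of `f` under
independent bits of bias `p`, which Markov's inequality bounds.

The hard inputs are `k` cycles of length `m = n / k` laid out as `k` columns and `m` layers, where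
bit `y j` shifts the columns cyclically at layer `j` (`twistedCycles`). The zero vector gives `k`
cycles, and any single twist merges them into one. Each edge bit depends on one `y j`, so the degree
does not increase under this substitution. Hence the sum is of order `m` for a correct algorithm, so
`S ^ (4 * R)` is at least of order `m`, which is at least of order `n ^ (1 - δ)`. -/

/-! ### Functions of bounded degree on the Boolean cube -/

/-- The value of the bit `i`, as a real function on the Boolean cube. -/
def bitValue {I : Type} (i : I) : (I → Bool) → ℝ := fun x => if x i then 1 else 0

/-- The real functions on the Boolean cube that are polynomials of degree at most `d` in the
bits. -/
def cubeDegreeLE (I : Type) (d : ℕ) : Submodule ℝ ((I → Bool) → ℝ) :=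
  (Submodule.span ℝ (insert 1 (Set.range bitValue))) ^ d

lemma cubeDegreeLE_mono (I : Type) {d e : ℕ} (h : d ≤ e) : cubeDegreeLE I d ≤ cubeDegreeLE I e := by
  refine pow_le_pow_right' ?_ h
  rw [Submodule.one_le]
  exact Submodule.subset_span (Set.mem_insert _ _)

lemma mul_mem_cubeDegreeLE {I : Type} {d e : ℕ} {f g : (I → Bool) → ℝ} (hf : f ∈ cubeDegreeLE I d)
    (hg : g ∈ cubeDegreeLE I e) : f * g ∈ cubeDegreeLE I (d + e) := by
  rw [cubeDegreeLE, pow_add]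
  exact Submodule.mul_mem_mul hf hg

lemma const_mem_cubeDegreeLE {I : Type} (d : ℕ) (c : ℝ) : (fun _ => c) ∈ cubeDegreeLE I d := by
  refine cubeDegreeLE_mono I (Nat.zero_le d) ?_
  rw [cubeDegreeLE, pow_zero, Submodule.mem_one]
  exact ⟨c, rfl⟩

lemma apply_bit_mem_cubeDegreeLE {I : Type} (i : I) (φ : Bool → ℝ) :
    (fun x : I → Bool => φ (x i)) ∈ cubeDegreeLE I 1 := by
  have h : (fun x : I → Bool => φ (x i)) =
      φ false • (1 : (I → Bool) → ℝ) + (φ true - φ false) • bitValue i := by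
    ext x
    cases hx : x i <;> simp [bitValue, hx]
  rw [h, cubeDegreeLE, pow_one]
  exact add_mem (Submodule.smul_mem _ _ (Submodule.subset_span (Set.mem_insert _ _)))
    (Submodule.smul_mem _ _ (Submodule.subset_span (Set.mem_insert_of_mem _ ⟨i, rfl⟩)))

/-- Substituting functions of single bits for the bits does not increase the degree. -/
lemma comp_mem_cubeDegreeLE {I J : Type} {d : ℕ} {f : (I → Bool) → ℝ} (hf : f ∈ cubeDegreeLE I d)
    (X : (J → Bool) → I → Bool) (hX : ∀ i, ∃ (j : J) (φ : Bool → Bool), ∀ y, X y i = φ (y j)) :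
    (fun y => f (X y)) ∈ cubeDegreeLE J d := by
  let T : ((I → Bool) → ℝ) →ₐ[ℝ] ((J → Bool) → ℝ) :=
    { toFun := fun f y => f (X y)
      map_one' := rfl
      map_mul' := fun _ _ => rfl
      map_zero' := rfl
      map_add' := fun _ _ => rfl
      commutes' := fun _ => rfl }
  have h : (cubeDegreeLE I d).map T.toLinearMap ≤ cubeDegreeLE J d := by
    rw [cubeDegreeLE, Submodule.map_pow]
    refine pow_le_pow_left' ?_ d
    rw [Submodule.map_span, Submodule.span_le]
    rintro _ ⟨g, rfl | ⟨i, rfl⟩, rfl⟩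
    · exact Submodule.subset_span (Set.mem_insert _ _)
    · obtain ⟨j, φ, hφ⟩ := hX i
      have := apply_bit_mem_cubeDegreeLE j (fun b => if φ b then (1 : ℝ) else 0)
      rw [cubeDegreeLE, pow_one] at this
      have hT : T.toLinearMap (bitValue i) = fun y => if φ (y j) then (1 : ℝ) else 0 := by
        ext y
        change (if X y i then (1 : ℝ) else 0) = _
        rw [hφ]
      rw [hT]
      exact this
  exact h ⟨f, hf, rfl⟩

/-- Branching on `w` adds degrees, however many branches there are: sum over the finitely many
values of `w` the indicator times the branch. Asking only for the product to factor lets a dead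
branch be replaced by zero. -/
lemma ite_eq_mul_mem_cubeDegreeLE {I M : Type} [Finite I] {d e : ℕ} (w : (I → Bool) → M)
    (g : M → (I → Bool) → ℝ)
    (h : ∀ m, ∃ u ∈ cubeDegreeLE I d, ∃ v ∈ cubeDegreeLE I e,
      ∀ x, (open Classical in if w x = m then (1 : ℝ) else 0) * g m x = u x * v x) :
    (fun x => g (w x) x) ∈ cubeDegreeLE I (d + e) := by
  classical
  have := Fintype.ofFinite I
  choose u hu v hv huv using h
  have key : (fun x => g (w x) x) = ∑ m ∈ Finset.univ.image w, u m * v m := by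
    ext x
    simp only [Finset.sum_apply, Pi.mul_apply, ← huv]
    rw [Finset.sum_eq_single (w x)]
    · simp
    · intro m _ hm
      simp [hm.symm]
    · simp
  rw [key]
  exact sum_mem fun m _ => mul_mem_cubeDegreeLE (hu m) (hv m)

/-- If at most `s` of the summands are nonzero, then a function of the sum has degree at most `s`
times the degree of a summand. -/
lemma exists_mem_cubeDegreeLE_eq_apply_sum {I ι M : Type} [Finite I] [AddCommMonoid M]
    (o : ι → (I → Bool) → M) (e : ℕ)
    (ho : ∀ v (Φ : M → ℝ), Φ 0 = 0 → (fun x => Φ (o v x)) ∈ cubeDegreeLE I e) (U : Finset ι) :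
    ∀ (s : ℕ) (Ψ : M → ℝ), ∃ g ∈ cubeDegreeLE I (s * e), ∀ x,
      (open Classical in (U.filter fun v => o v x ≠ 0).card ≤ s) → g x = Ψ (∑ v ∈ U, o v x) := by
  classical
  induction U using Finset.induction_on with
  | empty => exact fun s Ψ => ⟨_, const_mem_cubeDegreeLE _ (Ψ 0), by simp⟩
  | insert v U hv ih =>
    intro s Ψ
    rcases s with _ | s
    · refine ⟨_, const_mem_cubeDegreeLE _ (Ψ 0), fun x hx => ?_⟩
      have h0 : ∀ u ∈ insert v U, o u x = 0 := by
        simpa [Finset.filter_eq_empty_iff] using hx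
      rw [Finset.sum_eq_zero h0]
    · obtain ⟨g₁, hg₁, h₁⟩ := ih (s + 1) Ψ
      obtain ⟨g₂, hg₂, h₂⟩ := ih s Ψ
      choose g hg h using fun m => ih s (fun a => Ψ (m + a))
      -- The formula is `g₁ + [o v x ≠ 0] * (g (o v x) - g₂)`. If `o v x ≠ 0`, only `s` nonzero
      -- summands remain, so `g₁` and `g₂` agree and cancel. Multiplying `g₁` itself by an indicator
      -- would give the bound `(s + 2) * e`; the correction involves only polynomials for budget
      -- `s`.
      have key := ite_eq_mul_mem_cubeDegreeLE (d := e) (e := s * e) (o v)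
        (fun m x => if m = 0 then 0 else g m x - g₂ x) (fun m => by
          by_cases hm : m = 0
          · exact ⟨0, zero_mem _, 0, zero_mem _, by simp [hm]⟩
          · refine ⟨_, ho v (fun a => if a = m then 1 else 0) (by simp [Ne.symm hm]), _,
              sub_mem (hg m) hg₂, by simp [hm]⟩)
      refine ⟨_, add_mem hg₁ (cubeDegreeLE_mono I (by rw [add_mul, one_mul, add_comm]) key), ?_⟩
      intro x hx
      rw [Finset.sum_insert hv]
      by_cases h0 : o v x = 0
      · rw [Finset.filter_insert, if_neg (by simpa using h0)] at hx
        simp [h0, h₁ x hx]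
      · rw [Finset.filter_insert, if_pos h0, Finset.card_insert_of_notMem (by simp [hv])] at hx
        have hs := Nat.le_of_succ_le_succ hx
        simp [h0, h₁ x (by omega), h₂ x hs, h (o v x) x hs]

/-! ### The degree of an AMPC computation -/

lemma DDS.lookup_sum {I K V ι : Type} (U : Finset ι) (D : ι → DDS I K V) (a : DDSKey I K) :
    DDS.lookup (∑ v ∈ U, D v) a = ∑ v ∈ U, (D v).lookup a := by
  classical
  induction U using Finset.induction_on with
  | empty => simp [DDS.lookup]
  | insert v U hv ih =>
    rw [Finset.sum_insert hv, Finset.sum_insert hv, ← ih]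
    simp [DDS.lookup, Multiset.filter_add]

lemma DDS.apply_lookup_ofInput_mem_cubeDegreeLE {I : Type} [Fintype I] (K V : Type)
    (a : DDSKey I K) (Ψ : Multiset (DDSValue V) → ℝ) :
    (fun x => Ψ ((DDS.ofInput K V x).lookup a)) ∈ cubeDegreeLE I 1 := by
  classical
  rcases a with i | _ | a
  · have h : ∀ x : I → Bool, (DDS.ofInput K V x).lookup (.input i) = {DDSValue.bit (x i)} := by
      intro x
      simp only [DDS.lookup, DDS.ofInput, Multiset.filter_map, Function.comp_def,
        DDSKey.input.injEq, Multiset.map_map]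
      rw [← Finset.filter_val, Finset.filter_eq' Finset.univ i]
      simp
    simp only [h]
    exact apply_bit_mem_cubeDegreeLE i (fun b => Ψ {DDSValue.bit b})
  all_goals
    simp only [DDS.lookup, DDS.ofInput, Multiset.filter_map, Function.comp_def, reduceCtorEq,
      Multiset.filter_false, Multiset.map_zero]
    exact const_mem_cubeDegreeLE _ _

lemma one_le_responseCost {V : Type} (W : Multiset (DDSValue V)) : 1 ≤ responseCost W :=
  le_max_left _ _

/-- Every response costs at least 1, so the budget cuts the decision tree at depth `c`; each query
on a path contributes one indicator of degree `d`. -/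
lemma MachineProgram.apply_run_mem_cubeDegreeLE {I K V : Type} [Finite I] {d : ℕ}
    (D : (I → Bool) → DDS I K V)
    (hD : ∀ a (Ψ : Multiset (DDSValue V) → ℝ), (fun x => Ψ ((D x).lookup a)) ∈ cubeDegreeLE I d)
    (P : MachineProgram I K V) (Φ : Multiset (DDSKey I K × DDSValue V) → ℝ) (hΦ : Φ 0 = 0) :
    ∀ c : ℕ, (fun x => Φ (P.run (D x) c)) ∈ cubeDegreeLE I (c * d) := by
  classical
  induction P with
  | write out => exact fun c => const_mem_cubeDegreeLE _ (Φ out)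
  | query a next ih =>
    -- With no budget left, the bound `0 * d` has no room for an indicator, but the query is refused
    -- on every input and the value is `Φ 0`.
    rintro (_ | c)
    · have h : ∀ x, ¬ responseCost ((D x).lookup a) ≤ 0 := fun x => by
        have := one_le_responseCost ((D x).lookup a)
        omega
      simp only [MachineProgram.run, h, if_false, hΦ]
      exact const_mem_cubeDegreeLE _ 0
    · have key := ite_eq_mul_mem_cubeDegreeLE (d := d) (e := c * d) (fun x => (D x).lookup a)
        (fun W x => Φ (if responseCost W ≤ c + 1 then
          (next W).run (D x) (c + 1 - responseCost W) else 0)) (fun W => by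
          by_cases hW : responseCost W ≤ c + 1
          · refine ⟨_, hD a (fun W' => if W' = W then 1 else 0), _,
              cubeDegreeLE_mono I (Nat.mul_le_mul_right d ?_) (ih W (c + 1 - responseCost W)),
              by simp [hW]⟩
            have := one_le_responseCost W
            omega
          · exact ⟨0, zero_mem _, 0, zero_mem _, by simp [hW, hΦ]⟩)
      rw [add_mul, one_mul, add_comm]
      exact key

/-- After `r` rounds, the response to a query is a polynomial of degree at most `S ^ (2 r)`. -/
lemma AMPCAlgorithm.apply_lookup_mem_cubeDegreeLE {I : Type} [Fintype I] {Δ : Set (I → Bool)} {S : ℕ}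
    (A : AMPCAlgorithm I Δ S) {r : ℕ} (hr : r ≤ A.rounds) :
    ∀ (a : DDSKey I A.K) (Ψ : Multiset (DDSValue A.V) → ℝ),
      (fun x => Ψ ((A.dds S x r).lookup a)) ∈ cubeDegreeLE I ((S * S) ^ r) := by
  classical
  induction r with
  | zero => exact DDS.apply_lookup_ofInput_mem_cubeDegreeLE A.K A.V
  | succ r ih =>
    intro a Ψ
    have hrun := fun v => MachineProgram.apply_run_mem_cubeDegreeLE (fun x => A.dds S x r)
      (ih (Nat.le_of_succ_le hr)) (A.program r v)
    -- One factor `S` comes from the queries of a machine, the other from the number of machines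
    -- writing under the key `a`.
    obtain ⟨g, hg, h⟩ := exists_mem_cubeDegreeLE_eq_apply_sum
      (fun v x => DDS.lookup ((A.program r v).run (A.dds S x r) S) a) (S * (S * S) ^ r)
      (fun v Φ hΦ => hrun v (fun out => Φ (DDS.lookup out a)) (by simpa [DDS.lookup] using hΦ) S)
      Finset.univ S Ψ
    have hlookup : ∀ x, (A.dds S x (r + 1)).lookup a =
        ∑ v, DDS.lookup ((A.program r v).run (A.dds S x r) S) a := fun x => by
      rw [AMPCProtocol.dds, DDS.lookup_sum]
    have heq : (fun x => Ψ ((A.dds S x (r + 1)).lookup a)) = g := by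
      ext x
      rw [h x, hlookup]
      -- The bound is needed on invalid inputs too, since the polynomial identity must hold on the
      -- whole cube.
      have hcard := A.card_lookup_le x r hr a
      rw [hlookup, Multiset.card_sum] at hcard
      refine le_trans ?_ hcard
      rw [Finset.card_filter]
      refine Finset.sum_le_sum fun v _ => ?_
      split_ifs with hv
      · exact Multiset.card_pos.2 hv
      · exact Nat.zero_le _
    rw [heq, pow_succ']
    rwa [mul_assoc]

/-! ### Sensitivity at the origin versus degree -/

open Polynomial in
/-- Markov's inequality at the endpoint of an interval. -/
lemma derivative_eval_zero_le {Q : ℝ[X]} {d : ℕ} (hQ : Q.natDegree ≤ d)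
    (hbd : ∀ p ∈ Set.Icc (0 : ℝ) 1, Q.eval p ∈ Set.Icc (0 : ℝ) 1) :
    Q.derivative.eval 0 ≤ (d : ℝ) ^ 2 := by
  -- This rescaling maps [-1, 1] to [-1, 1] and gives `P'(1) = Q'(0)`. The Chebyshev polynomial is
  -- extremal, with `T_d'(1) = d ^ 2`.
  set P : ℝ[X] := 1 - C 2 * Q.comp (C (1 / 2) - C (1 / 2) * X) with hP
  have hlin : (C (1 / 2 : ℝ) - C (1 / 2) * X).natDegree ≤ 1 := by compute_degree
  have hdeg : P.degree ≤ d := by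
    refine degree_le_of_natDegree_le ((natDegree_sub_le _ _).trans (max_le (by simp) ?_))
    refine (natDegree_C_mul_le _ _).trans (natDegree_comp_le.trans ?_)
    calc _ ≤ d * 1 := Nat.mul_le_mul hQ hlin
      _ = d := mul_one d
  have hle := Chebyshev.eval_iterate_derivative_le_of_forall_abs_le_one (k := 1) le_rfl hdeg
    (fun x hx => by
      have h := hbd (1 / 2 - 1 / 2 * x) ⟨by linarith [hx.2], by linarith [hx.1]⟩
      simp only [hP, eval_sub, eval_one, eval_mul, eval_C, eval_comp, eval_X]
      rw [abs_le]
      constructor <;> linarith [h.1, h.2])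
  simp only [Function.iterate_one, Chebyshev.derivative_T_eval_one] at hle
  refine le_trans (le_of_eq ?_) hle
  simp only [hP, derivative_sub, derivative_one, derivative_mul, derivative_C, derivative_comp,
    derivative_X, eval_sub, eval_add, eval_mul, eval_C, eval_comp, eval_X, eval_zero]
  norm_num
  ring

-- Bits are idempotent on the cube, so repeated factors collapse and monomials become multilinear.
open Pointwise in
lemma exists_finset_of_mem_pow {I : Type} [DecidableEq I] {d : ℕ} {f : (I → Bool) → ℝ}
    (hf : f ∈ (insert 1 (Set.range bitValue) : Set ((I → Bool) → ℝ)) ^ d) :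
    ∃ T : Finset I, T.card ≤ d ∧ f = ∏ i ∈ T, bitValue i := by
  induction d generalizing f with
  | zero => exact ⟨∅, by simp, by simpa using hf⟩
  | succ d ih =>
    rw [pow_succ] at hf
    obtain ⟨g, hg, b, hb, rfl⟩ := Set.mem_mul.1 hf
    obtain ⟨T, hT, rfl⟩ := ih hg
    rcases hb with rfl | ⟨i, rfl⟩
    · exact ⟨T, by omega, by simp⟩
    by_cases hi : i ∈ T
    · refine ⟨T, by omega, ?_⟩
      rw [← Finset.mul_prod_erase T _ hi]
      ext x
      cases hx : x i <;> simp [bitValue, hx]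
    · exact ⟨insert i T, by rw [Finset.card_insert_of_notMem hi]; omega,
        by rw [Finset.prod_insert hi, mul_comm]⟩

/-- The probability of `y` if the bits are independent and equal to `1` with probability `p`. -/
def bernoulliWeight {I : Type} [Fintype I] (p : ℝ) (y : I → Bool) : ℝ :=
  ∏ i, if y i then p else 1 - p

lemma sum_bernoulliWeight_mul_prod {I : Type} [Fintype I] [DecidableEq I] (p : ℝ)
    (T : Finset I) : ∑ y, bernoulliWeight p y * ∏ i ∈ T, bitValue i y = p ^ T.card := by
  have h : ∀ y : I → Bool, bernoulliWeight p y * ∏ i ∈ T, bitValue i y =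
      ∏ i, (if y i then p else if i ∈ T then 0 else 1 - p) := by
    intro y
    rw [bernoulliWeight, ← Finset.prod_ite_mem_eq T, ← Finset.prod_mul_distrib]
    refine Finset.prod_congr rfl fun i _ => ?_
    cases hy : y i <;> by_cases hi : i ∈ T <;> simp [bitValue, hy, hi]
  simp only [h]
  rw [← Fintype.prod_sum (fun (i : I) (b : Bool) => if b then p else if i ∈ T then 0 else 1 - p)]
  have h' : ∀ i, ∑ b : Bool, (if b then p else if i ∈ T then 0 else 1 - p) =
      if i ∈ T then p else 1 := by
    intro i
    by_cases hi : i ∈ T <;> simp [hi]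
  simp only [h']
  simp [Finset.prod_ite_mem]

/-- The input in which exactly the bit `i` is `1`. -/
def singleBit {I : Type} [DecidableEq I] (i : I) : I → Bool := fun j => decide (j = i)

-- All the conditions are compatible with linear combinations of `f`, so monomials suffice. The
-- monomial on `T` has expectation `p ^ T.card`; its derivative at 0 and its sum of differences are
-- both 1 if `T` is a singleton and 0 otherwise.
open Polynomial in
lemma exists_polynomial_of_mem_cubeDegreeLE {I : Type} [Fintype I] [DecidableEq I] {d : ℕ}
    {f : (I → Bool) → ℝ} (hf : f ∈ cubeDegreeLE I d) :
    ∃ Q : ℝ[X], Q.natDegree ≤ d ∧ (∀ p, Q.eval p = ∑ y, bernoulliWeight p y * f y) ∧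
      Q.derivative.eval 0 = ∑ i, (f (singleBit i) - f fun _ => false) := by
  rw [cubeDegreeLE, Submodule.span_pow] at hf
  induction hf using Submodule.span_induction with
  | mem f hf =>
    obtain ⟨T, hT, rfl⟩ := exists_finset_of_mem_pow hf
    refine ⟨X ^ T.card, by simpa using hT, fun p => ?_, ?_⟩
    · simp [← sum_bernoulliWeight_mul_prod]
    · have h : ∀ i : I, (∏ j ∈ T, bitValue j) (singleBit i) = if T ⊆ {i} then 1 else 0 := by
        intro i
        simp only [Finset.prod_apply, bitValue, singleBit, Finset.prod_ite_zero, decide_eq_true_eq,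
          Finset.prod_const_one]
        congr 1
        simp [Finset.subset_iff]
      have h0 : (∏ j ∈ T, bitValue j) (fun _ => false) = if T = ∅ then 1 else 0 := by
        simp only [Finset.prod_apply, bitValue, Finset.prod_ite_zero, Finset.prod_const_one]
        simp [Finset.eq_empty_iff_forall_notMem]
      simp only [h, h0]
      rcases T.eq_empty_or_nonempty with rfl | hne
      · simp
      · simp only [Finset.subset_singleton_iff, hne.ne_empty, false_or, if_false, sub_zero,
          derivative_X_pow, eval_mul, eval_pow, eval_X]
        by_cases hc : T.card = 1
        · obtain ⟨i, rfl⟩ := Finset.card_eq_one.1 hc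
          simp
        · rw [Finset.sum_eq_zero]
          · have := hne.card_pos
            have : T.card - 1 ≠ 0 := by omega
            simp [this]
          · intro i _
            rw [if_neg]
            rintro rfl
            simp at hc
  | zero => exact ⟨0, by simp, by simp, by simp⟩
  | add f g _ _ hf hg =>
    obtain ⟨P, hP, hP', hP''⟩ := hf
    obtain ⟨Q, hQ, hQ', hQ''⟩ := hg
    refine ⟨P + Q, natDegree_add_le_of_degree_le hP hQ, fun p => ?_, ?_⟩
    · simp [hP', hQ', mul_add, Finset.sum_add_distrib]
    · simp only [derivative_add, eval_add, hP'', hQ'', Pi.add_apply, ← Finset.sum_add_distrib]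
      exact Finset.sum_congr rfl fun i _ => by ring
  | smul c f _ hf =>
    obtain ⟨P, hP, hP', hP''⟩ := hf
    refine ⟨c • P, (natDegree_smul_le _ _).trans hP, fun p => ?_, ?_⟩
    · simp only [eval_smul, hP', smul_eq_mul, Pi.smul_apply, Finset.mul_sum]
      exact Finset.sum_congr rfl fun y _ => by ring
    · simp only [derivative_smul, eval_smul, hP'', smul_eq_mul, Pi.smul_apply, Finset.mul_sum]
      exact Finset.sum_congr rfl fun i _ => by ring

/-- The sensitivity at `0` of a bounded function on the cube is at most the square of its
degree. -/
theorem sum_singleBit_sub_le {I : Type} [Fintype I] [DecidableEq I] {d : ℕ}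
    {f : (I → Bool) → ℝ} (hf : f ∈ cubeDegreeLE I d) (hbd : ∀ y, f y ∈ Set.Icc (0 : ℝ) 1) :
    ∑ i, (f (singleBit i) - f fun _ => false) ≤ (d : ℝ) ^ 2 := by
  obtain ⟨Q, hdeg, heval, hder⟩ := exists_polynomial_of_mem_cubeDegreeLE hf
  rw [← hder]
  refine derivative_eval_zero_le hdeg fun p hp => ?_
  have hw : ∀ y : I → Bool, 0 ≤ bernoulliWeight p y := fun y =>
    Finset.prod_nonneg fun i _ => by split_ifs <;> linarith [hp.1, hp.2]
  have hsum : ∑ y : I → Bool, bernoulliWeight p y = 1 := by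
    simpa using sum_bernoulliWeight_mul_prod (I := I) p ∅
  rw [heval]
  refine ⟨Finset.sum_nonneg fun y _ => mul_nonneg (hw y) (hbd y).1, ?_⟩
  rw [← hsum]
  exact Finset.sum_le_sum fun y _ => mul_le_of_le_one_right (hw y) (hbd y).2

/-! ### A family of inputs: `k` cycles and single cycles -/

/-- The graph in which each vertex is joined to its successor. -/
def successorGraph {V : Type} (σ : V → V) : SimpleGraph V := SimpleGraph.fromRel fun u v => v = σ u

lemma successorGraph_adj {V : Type} {σ : V → V} {u v : V} :
    (successorGraph σ).Adj u v ↔ u ≠ v ∧ (v = σ u ∨ u = σ v) := Iff.rfl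

/-- A bijection that commutes with the successors is a graph isomorphism. -/
def successorGraphIso {V W : Type} {σ : V → V} {τ : W → W} (φ : V ≃ W)
    (h : ∀ u, φ (σ u) = τ (φ u)) : successorGraph σ ≃g successorGraph τ where
  toEquiv := φ
  map_rel_iff' := by simp [successorGraph_adj, ← h]

lemma cycleGraph_eq_successorGraph {n : ℕ} [NeZero n] (hn : 2 ≤ n) :
    SimpleGraph.cycleGraph n = successorGraph fun a => a + 1 := by
  obtain ⟨n, rfl⟩ := Nat.exists_eq_add_of_le' hn
  ext a b
  rw [SimpleGraph.cycleGraph_adj, successorGraph_adj, sub_eq_iff_eq_add', sub_eq_iff_eq_add',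
    add_comm b, add_comm a, add_comm 1 b, add_comm 1 a, or_comm]
  refine ⟨fun h => ⟨?_, h⟩, fun h => h.2⟩
  rintro rfl
  simp at h

/-- The input that encodes a graph. -/
noncomputable def bitsOfGraph {n : ℕ} (G : SimpleGraph (Fin n)) : PotentialEdge n → Bool :=
  fun e => open Classical in decide (e.1 ∈ G.edgeSet)

lemma graphOfBits_bitsOfGraph {n : ℕ} (G : SimpleGraph (Fin n)) :
    graphOfBits (bitsOfGraph G) = G := by
  ext a b
  simp only [graphOfBits, bitsOfGraph, SimpleGraph.fromEdgeSet_adj, Set.mem_ofPred_eq,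
    decide_eq_true_eq, SimpleGraph.mem_edgeSet, Sym2.mk_isDiag_iff, exists_prop, and_assoc]
  exact ⟨fun h => h.2.1, fun h => ⟨h.ne, h, h.ne⟩⟩

/-- Moves to the next of the `m` layers of `Fin k × Fin m`, and to the next column if the bit of
the layer is set. -/
def twistedSucc {k m : ℕ} [NeZero k] [NeZero m] (y : Fin m → Bool) (u : Fin k × Fin m) :
    Fin k × Fin m := (if y u.2 then u.1 + 1 else u.1, u.2 + 1)

/-- `k` disjoint cycles, twisted at the layers whose bit is set. -/
noncomputable def twistedCycles {k m : ℕ} [NeZero k] [NeZero m] (y : Fin m → Bool) :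
    PotentialEdge (k * m) → Bool :=
  bitsOfGraph ((successorGraph (twistedSucc (k := k) y)).comap finProdFinEquiv.symm)

/-- The graph encoded by `twistedCycles`, on the vertex set `Fin k × Fin m`. -/
noncomputable def graphOfBitsTwistedCyclesIso {k m : ℕ} [NeZero k] [NeZero m] (y : Fin m → Bool) :
    graphOfBits (twistedCycles (k := k) y) ≃g successorGraph (twistedSucc (k := k) y) where
  toEquiv := finProdFinEquiv.symm
  map_rel_iff' := by
    intro a b
    rw [twistedCycles, graphOfBits_bitsOfGraph]
    rfl

lemma Fin.add_one_add_one_ne_self {m : ℕ} [NeZero m] (hm : 3 ≤ m) (t : Fin m) : t + 1 + 1 ≠ t := by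
  obtain ⟨m, rfl⟩ := Nat.exists_eq_add_of_le' hm
  rw [add_assoc]
  intro h
  have := congrArg Fin.val (add_eq_left.1 h)
  rw [Fin.val_add, Fin.val_one, Fin.val_zero, Nat.mod_eq_of_lt (by omega)] at this
  omega

/-- An edge from layer `t` to layer `t + 1` is governed by the bit of layer `t` alone. With two
layers, a pair could be joined in either direction and two bits would matter; `3 ≤ m` excludes this.
-/
lemma twistedCycles_apply {k m : ℕ} [NeZero k] [NeZero m] (hm : 3 ≤ m)
    (e : PotentialEdge (k * m)) :
    ∃ (j : Fin m) (φ : Bool → Bool), ∀ y, twistedCycles (k := k) y e = φ (y j) := by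
  suffices h : ∃ j : Fin m, ∀ y y' : Fin m → Bool, y j = y' j →
      twistedCycles (k := k) y e = twistedCycles y' e by
    obtain ⟨j, hj⟩ := h
    -- `φ` is read off from the constant vectors `y`.
    exact ⟨j, fun b => twistedCycles (fun _ => b) e, fun y => hj _ _ rfl⟩
  obtain ⟨e, he⟩ := e
  induction e using Sym2.ind with
  | _ a b =>
    simp only [twistedCycles, bitsOfGraph, SimpleGraph.mem_edgeSet, SimpleGraph.comap_adj,
      successorGraph_adj, decide_eq_decide]
    set u := finProdFinEquiv.symm a
    set v := finProdFinEquiv.symm b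
    by_cases h : v.2 = u.2 + 1
    · refine ⟨u.2, fun y y' hy => ?_⟩
      have hne : u.2 ≠ v.2 + 1 := by
        rw [h]
        exact (Fin.add_one_add_one_ne_self hm _).symm
      simp [twistedSucc, Prod.ext_iff, hy, hne]
    · refine ⟨v.2, fun y y' hy => ?_⟩
      simp [twistedSucc, Prod.ext_iff, hy, h]

/-- Adding 1 to `u + m * i` acts as an odometer: the column advances exactly when the layer wraps
around. -/
lemma finProdFinEquiv_succ {k m : ℕ} [NeZero k] [NeZero m] (i : Fin k) (u : Fin m) :
    finProdFinEquiv (if u + 1 = 0 then i + 1 else i, u + 1) = finProdFinEquiv (i, u) + 1 := by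
  have hu := u.isLt
  have hi := i.isLt
  have hval : (u + 1).val = (u.val + 1) % m := by simp [Fin.val_add]
  have hmod : u + 1 = 0 ↔ u.val + 1 = m := by
    rw [Fin.ext_iff, hval, Fin.val_zero]
    constructor
    · intro h
      by_contra hne
      rw [Nat.mod_eq_of_lt (by omega)] at h
      omega
    · intro h
      rw [h, Nat.mod_self]
  ext
  by_cases h : u.val + 1 = m
  · have h1 : u.val + m * i.val + 1 = m * (i.val + 1) := by
      rw [mul_add, mul_one]
      omega
    simp [hmod, h, Fin.val_add, hval, h1, mul_comm k m, Nat.mul_mod_mul_left]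
  · have h1 : u.val + m * i.val + 1 < k * m := by
      calc u.val + m * i.val + 1 < m * (i.val + 1) := by rw [mul_add, mul_one]; omega
        _ ≤ m * k := Nat.mul_le_mul_left m hi
        _ = k * m := mul_comm _ _
    simp [hmod, h, Fin.val_add, hval, Nat.mod_eq_of_lt h1,
      Nat.mod_eq_of_lt (show u.val + 1 < m by omega)]
    omega

lemma isOneCycle_twistedCycles_singleBit {k m : ℕ} [NeZero k] [NeZero m] (hkm : 2 ≤ k * m)
    (j : Fin m) : IsOneCycle (twistedCycles (k := k) (singleBit j)) := by
  rw [IsOneCycle, cycleGraph_eq_successorGraph hkm]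
  -- Rotating the layers by `j + 1` makes the twisted layer `j` the last one, so the twist becomes
  -- the carry of the odometer.
  let ψ : Fin k × Fin m ≃ Fin (k * m) :=
    (Equiv.prodCongrRight fun _ => Equiv.subRight (j + 1)).trans finProdFinEquiv
  refine ⟨(graphOfBitsTwistedCyclesIso _).trans (successorGraphIso ψ ?_)⟩
  rintro ⟨i, t⟩
  change finProdFinEquiv (_, t + 1 - (j + 1)) = finProdFinEquiv (i, t - (j + 1)) + 1
  rw [← finProdFinEquiv_succ, sub_add_eq_add_sub]
  congr 2
  simp [twistedSucc, singleBit, sub_eq_zero]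

lemma disjointCycles_eq_successorGraph {k m : ℕ} [NeZero k] [NeZero m] (hm : 2 ≤ m) :
    disjointCycles k m = successorGraph (twistedSucc fun _ => false) := by
  ext ⟨i, t⟩ ⟨i', t'⟩
  simp only [disjointCycles, cycleGraph_eq_successorGraph hm, successorGraph_adj, twistedSucc,
    Prod.ext_iff, ne_eq]
  grind

lemma isKCycles_twistedCycles_zero {k m : ℕ} [NeZero k] [NeZero m] (hm : 2 ≤ m) :
    IsKCycles k (twistedCycles (k := k) (m := m) fun _ => false) := by
  rw [IsKCycles, Nat.mul_div_cancel_left _ (NeZero.pos k), disjointCycles_eq_successorGraph hm]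
  exact ⟨graphOfBitsTwistedCyclesIso _⟩

/-- The column is constant along walks. -/
lemma not_preconnected_disjointCycles {k m : ℕ} (hk : 2 ≤ k) (hm : 0 < m) :
    ¬ (disjointCycles k m).Preconnected := by
  intro h
  have hreach : ∀ u v, (disjointCycles k m).Reachable u v → u.1 = v.1 := by
    rintro u v ⟨w⟩
    induction w with
    | nil => rfl
    | cons hadj _ ih => exact hadj.1.trans ih
  have := hreach _ _ (h (⟨0, by omega⟩, ⟨0, hm⟩) (⟨1, by omega⟩, ⟨0, hm⟩))
  simp at this

lemma IsKCycles.not_isOneCycle {n k : ℕ} (hk : 2 ≤ k) (hkn : k ≤ n)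
    {x : PotentialEdge n → Bool} (h : IsKCycles k x) : ¬ IsOneCycle x := by
  rintro ⟨φ⟩
  obtain ⟨ψ⟩ := h
  refine not_preconnected_disjointCycles hk (Nat.div_pos hkn (by omega)) ?_
  exact ψ.preconnected_iff.1 (φ.preconnected_iff.2 SimpleGraph.cycleGraph_preconnected)

/-! ### The lower bound -/

/-- The final response to the query `answer` is the single value `1`. -/
def AMPCAlgorithm.Accepts {I : Type} [Fintype I] {Δ : Set (I → Bool)} {S : ℕ}
    (A : AMPCAlgorithm I Δ S) (x : I → Bool) : Prop :=
  (A.dds S x A.rounds).lookup DDSKey.answer = {DDSValue.bit true}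

lemma AMPCAlgorithm.Outputs.accepts_iff {I : Type} [Fintype I] {Δ : Set (I → Bool)} {S : ℕ}
    {A : AMPCAlgorithm I Δ S} {x : I → Bool} {b : Bool} (h : A.Outputs x b) :
    A.Accepts x ↔ b = true := by
  rw [AMPCAlgorithm.Outputs] at h
  simp [AMPCAlgorithm.Accepts, h, DDS.lookup, Multiset.filter_singleton]

open Classical in
/-- If each bit of the input depends on a single bit of `y`, then an algorithm that rejects `0`
accepts few of the inputs `y` with a single bit. -/
lemma AMPCAlgorithm.sum_accepts_singleBit_le {I : Type} [Fintype I] {Δ : Set (I → Bool)} {S m : ℕ}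
    (A : AMPCAlgorithm I Δ S) {R : ℕ} (hR : A.rounds ≤ R) (X : (Fin m → Bool) → I → Bool)
    (hX : ∀ i, ∃ (j : Fin m) (φ : Bool → Bool), ∀ y, X y i = φ (y j)) :
    ∑ j, (if A.Accepts (X (singleBit j)) then 1 else 0) ≤
      m * (if A.Accepts (X fun _ => false) then 1 else 0) + max S 1 ^ (4 * R) := by
  -- Acceptance is a test on one response, so it is 0/1-valued on the whole cube, including vectors
  -- `y` whose graph is not a valid input.
  set Ψ : Multiset (DDSValue A.V) → ℝ := fun W => if W = {DDSValue.bit true} then 1 else 0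
  -- Taking `max S 1` keeps powers monotone in the exponent even when `S = 0`.
  have hdeg : (S * S) ^ A.rounds ≤ max S 1 ^ (2 * R) := by
    rw [← pow_two, ← pow_mul]
    exact (Nat.pow_le_pow_left (le_max_left S 1) _).trans
      (Nat.pow_le_pow_right (le_max_right S 1) (by omega))
  have h := sum_singleBit_sub_le
    (comp_mem_cubeDegreeLE (cubeDegreeLE_mono I hdeg
      (A.apply_lookup_mem_cubeDegreeLE le_rfl DDSKey.answer Ψ)) X hX)
    (fun y => by
      simp only [Ψ]
      split_ifs <;> simp)
  have hacc : ∀ x, Ψ ((A.dds S x A.rounds).lookup DDSKey.answer) =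
      ((if A.Accepts x then 1 else 0 : ℕ) : ℝ) := by
    intro x
    by_cases hx : A.Accepts x
    · rw [if_pos hx, Nat.cast_one]
      exact if_pos hx
    · rw [if_neg hx, Nat.cast_zero]
      exact if_neg hx
  simp only [hacc, Finset.sum_sub_distrib, Finset.sum_const, Finset.card_univ, Fintype.card_fin,
    nsmul_eq_mul] at h
  have h' : (max S 1 ^ (2 * R)) ^ 2 = max S 1 ^ (4 * R) := by
    rw [← pow_mul]
    congr 1
    omega
  rw [← h', ← Nat.cast_le (α := ℝ)]
  push_cast at h ⊢
  linarith

/-! ### Averaging over a randomized algorithm -/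

open Classical in
/-- Taking expectations in a linear inequality between indicators. -/
lemma PMF.sum_toOuterMeasure_le {α : Type*} {ι : Type*} [Fintype ι] (P : PMF α)
    (s : ι → Set α) (t : Set α) (m D : ℕ)
    (h : ∀ a ∈ P.support, ∑ i, (if a ∈ s i then 1 else 0) ≤ m * (if a ∈ t then 1 else 0) + D) :
    ∑ i, P.toOuterMeasure (s i) ≤ m * P.toOuterMeasure t + D := by
  have hind : ∀ (u : Set α) a, u.indicator P a = P a * ((if a ∈ u then 1 else 0 : ℕ) : ENNReal) := by
    intro u a
    by_cases ha : a ∈ u <;> simp [ha]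
  simp only [PMF.toOuterMeasure_apply]
  calc ∑ i, ∑' a, (s i).indicator P a = ∑' a, ∑ i, (s i).indicator P a :=
        (Summable.tsum_finsetSum fun _ _ => ENNReal.summable).symm
    _ ≤ ∑' a, (m * t.indicator P a + D * P a) := by
        refine ENNReal.tsum_le_tsum fun a => ?_
        by_cases ha : a ∈ P.support
        · have := (Nat.cast_le (α := ENNReal)).2 (h a ha)
          simp only [hind, ← Finset.mul_sum]
          calc P a * ∑ i, ((if a ∈ s i then 1 else 0 : ℕ) : ENNReal)
              ≤ P a * ((m * (if a ∈ t then 1 else 0) + D : ℕ) : ENNReal) := by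
                rw [← Nat.cast_sum]
                gcongr
            _ = _ := by
                push_cast
                ring
        · rw [PMF.mem_support_iff, not_not] at ha
          simp [hind, ha]
    _ = m * ∑' a, t.indicator P a + D := by
        rw [ENNReal.tsum_add, ENNReal.tsum_mul_left, ENNReal.tsum_mul_left, P.tsum_coe, mul_one]

lemma PMF.toOuterMeasure_add_le_one {α : Type*} (P : PMF α) {s t : Set α} (h : Disjoint s t) :
    P.toOuterMeasure s + P.toOuterMeasure t ≤ 1 := by
  rw [PMF.toOuterMeasure_apply, PMF.toOuterMeasure_apply, ← ENNReal.tsum_add, ← P.tsum_coe]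
  refine ENNReal.tsum_le_tsum fun a => ?_
  rw [← congrFun (Set.indicator_union_of_disjoint h P) a]
  exact Set.indicator_le_self _ _ _

/-- An algorithm for the problem with `k` cycles of length `m` needs many rounds. -/
lemma RandomizedAMPCAlgorithm.two_mul_le_of_computesWithError {k m S R : ℕ} (hk : 2 ≤ k)
    (hm : 3 ≤ m)
    (P : RandomizedAMPCAlgorithm (PotentialEdge (k * m)) (oneVsKCycleDomain (k * m) k) S)
    (hP : P.ComputesWithError (oneVsKCycle (k * m) k) (1 / 6)) (hR : P.RoundsAtMost R) :
    2 * m ≤ 3 * max S 1 ^ (4 * R) := by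
  have : NeZero k := ⟨by omega⟩
  have : NeZero m := ⟨by omega⟩
  have hkm : k ≤ k * m := Nat.le_mul_of_pos_right k (by omega)
  have hexp := PMF.sum_toOuterMeasure_le P
    (fun j => {A | A.Accepts (twistedCycles (k := k) (singleBit j))})
    {A | A.Accepts (twistedCycles (k := k) fun _ => false)} m (max S 1 ^ (4 * R))
    (fun A hA => A.sum_accepts_singleBit_le (hR A hA) _ (twistedCycles_apply hm))
  have hone : ∀ j : Fin m, ENNReal.ofReal (5 / 6) ≤
      P.toOuterMeasure {A | A.Accepts (twistedCycles (k := k) (singleBit j))} := by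
    intro j
    have hj : IsOneCycle (twistedCycles (k := k) (singleBit j)) :=
      isOneCycle_twistedCycles_singleBit (hk.trans hkm) j
    refine le_trans ?_ ((hP ⟨_, Or.inl hj⟩).trans (MeasureTheory.measure_mono fun A hA => ?_))
    · exact ENNReal.ofReal_le_ofReal (by norm_num)
    · exact (AMPCAlgorithm.Outputs.accepts_iff hA).2 (by simp [oneVsKCycle, hj])
  have hzero : P.toOuterMeasure {A | A.Accepts (twistedCycles (k := k) fun _ : Fin m => false)} ≤
      ENNReal.ofReal (1 / 6) := by
    have h0 : IsKCycles k (twistedCycles (k := k) fun _ : Fin m => false) :=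
      isKCycles_twistedCycles_zero (by omega)
    have hrej := hP ⟨_, Or.inr h0⟩
    -- Accepting is incompatible with the correct output 0, which has probability at least 5/6.
    have hdisj := P.toOuterMeasure_add_le_one
      (s := {A | A.Accepts (twistedCycles (k := k) fun _ : Fin m => false)})
      (t := {A | A.Outputs (twistedCycles (k := k) fun _ : Fin m => false)
        (oneVsKCycle (k * m) k ⟨_, Or.inr h0⟩)})
      (Set.disjoint_left.2 fun A hA hA' => by
        have := (AMPCAlgorithm.Outputs.accepts_iff hA').1 hA
        simp [oneVsKCycle, h0.not_isOneCycle hk hkm] at this)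
    have h1 : ENNReal.ofReal (1 / 6) + ENNReal.ofReal (1 - 1 / 6) = 1 := by
      rw [← ENNReal.ofReal_add (by norm_num) (by norm_num)]
      norm_num
    rw [← h1] at hdisj
    refine (ENNReal.add_le_add_iff_right ENNReal.ofReal_ne_top).1
      (le_trans (add_le_add le_rfl hrej) hdisj)
  -- In expectation `5/6 * m ≤ 1/6 * m + S ^ (4 * R)` (with `max S 1` for `S`), which rearranges to
  -- the claim.
  have hle : (m : ENNReal) * ENNReal.ofReal (5 / 6) ≤
      m * ENNReal.ofReal (1 / 6) + (max S 1 ^ (4 * R) : ℕ) := by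
    refine le_trans ?_ (hexp.trans (by gcongr))
    calc (m : ENNReal) * ENNReal.ofReal (5 / 6) = ∑ _j : Fin m, ENNReal.ofReal (5 / 6) := by simp
      _ ≤ _ := Finset.sum_le_sum fun j _ => hone j
  rw [← ENNReal.ofReal_natCast m, ← ENNReal.ofReal_natCast (_ ^ _),
    ← ENNReal.ofReal_mul (by positivity), ← ENNReal.ofReal_mul (by positivity),
    ← ENNReal.ofReal_add (by positivity) (by positivity),
    ENNReal.ofReal_le_ofReal_iff (by positivity)] at hle
  have : (2 * m : ℝ) ≤ 3 * (max S 1 ^ (4 * R) : ℕ) := by linarith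
  exact_mod_cast this

/-! ### From the degree bound to the number of rounds -/

/-- Here `C * m ≥ n ^ (1 - δ)`. Half of this exponent is spent on beating `3 * C`, which also forces
`3 ≤ m`; the other half is compared with `S ^ (4 * R) ≤ n ^ (4 * R * ε)`. This gives the constant
`(1 - δ) / 8`, and the threshold on `n` does not depend on `ε`, `S` or `R`. -/
lemma exists_forall_le_rounds (δ : ℝ) (hδ₁ : δ < 1) (C : ℝ) :
    ∃ n₀ : ℕ, ∀ k m : ℕ, n₀ ≤ k * m → 2 ≤ k → (k : ℝ) ≤ C * ((k * m : ℕ) : ℝ) ^ δ →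
      3 ≤ m ∧ ∀ ε : ℝ, 0 < ε → ∀ S R : ℕ, (S : ℝ) ≤ ((k * m : ℕ) : ℝ) ^ ε →
        2 * m ≤ 3 * max S 1 ^ (4 * R) → (1 - δ) / 8 / ε ≤ R := by
  have hlim := (tendsto_rpow_atTop (show 0 < (1 - δ) / 2 by linarith)).comp
    tendsto_natCast_atTop_atTop
  obtain ⟨n₁, hn₁⟩ := Filter.eventually_atTop.1 (hlim.eventually_gt_atTop (3 * C))
  refine ⟨max n₁ 1, fun k m hn hk hkC => ?_⟩
  have hbig : 3 * C < ((k * m : ℕ) : ℝ) ^ ((1 - δ) / 2) := hn₁ _ ((le_max_left _ _).trans hn)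
  set n : ℝ := ((k * m : ℕ) : ℝ) with hn_def
  have h1 : 1 ≤ n := Nat.one_le_cast.2 ((le_max_right _ _).trans hn)
  have h0 : 0 < n := by linarith
  have hC : 0 < C := by
    have : 0 < C * n ^ δ := lt_of_lt_of_le (by positivity) hkC
    exact pos_of_mul_pos_left this (by positivity)
  have hm : n ^ (1 - δ) ≤ C * m := by
    rw [Real.rpow_sub h0, Real.rpow_one, div_le_iff₀ (by positivity)]
    calc n = k * m := by rw [hn_def]; push_cast; ring
      _ ≤ C * n ^ δ * m := by gcongr
      _ = C * m * n ^ δ := by ring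
  have hsq : n ^ (1 - δ) = n ^ ((1 - δ) / 2) * n ^ ((1 - δ) / 2) := by
    rw [← Real.rpow_add h0]
    congr 1
    ring
  have hhalf : 1 ≤ n ^ ((1 - δ) / 2) := Real.one_le_rpow h1 (by linarith)
  constructor
  · have : C * 3 < C * m := by nlinarith
    exact_mod_cast (lt_of_mul_lt_mul_left this hC.le).le
  · intro ε hε S R hS hmS
    by_contra hR
    rw [not_le, lt_div_iff₀ hε] at hR
    have hB : ((max S 1 : ℕ) : ℝ) ≤ n ^ ε := by
      rw [Nat.cast_max, Nat.cast_one]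
      exact max_le hS (Real.one_le_rpow h1 hε.le)
    have hpow : ((max S 1 : ℕ) : ℝ) ^ (4 * R) ≤ n ^ ((1 - δ) / 2) := by
      calc ((max S 1 : ℕ) : ℝ) ^ (4 * R) ≤ (n ^ ε) ^ (4 * R) := by gcongr
        _ = n ^ (ε * (4 * R : ℕ)) := by rw [Real.rpow_mul h0.le, Real.rpow_natCast]
        _ ≤ n ^ ((1 - δ) / 2) := by
          refine Real.rpow_le_rpow_of_exponent_le h1 ?_
          push_cast
          nlinarith
    have hmS' : (2 * m : ℝ) ≤ 3 * ((max S 1 : ℕ) : ℝ) ^ (4 * R) := by exact_mod_cast hmS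
    -- Cancelling one factor leaves `n ^ ((1 - δ) / 2) ≤ 3 / 2 * C`, contradicting `hbig`.
    have : n ^ ((1 - δ) / 2) * n ^ ((1 - δ) / 2) ≤ C * (3 / 2 * n ^ ((1 - δ) / 2)) := by
      rw [← hsq]
      exact hm.trans (by gcongr; linarith)
    nlinarith

theorem mainTheorem3 (δ : ℝ) (hδ₀ : 0 < δ) (hδ₁ : δ < 1) :
    ∃ c : ℝ, 0 < c ∧ ∀ C : ℝ, ∃ n₀ : ℕ, ∀ n k : ℕ, n₀ ≤ n → 2 ≤ k → k ∣ n →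
      (k : ℝ) ≤ C * (n : ℝ) ^ δ →
      ∀ ε : ℝ, 0 < ε → ∀ S : ℕ, (S : ℝ) ≤ (n : ℝ) ^ ε →
        (∀ A : AMPCAlgorithm (PotentialEdge n) (oneVsKCycleDomain n k) S,
          A.Computes (oneVsKCycle n k) → c / ε ≤ (A.rounds : ℝ)) ∧
        (∀ P : RandomizedAMPCAlgorithm (PotentialEdge n) (oneVsKCycleDomain n k) S,
          P.ComputesWithError (oneVsKCycle n k) (1 / 6) →
          ∀ R : ℕ, P.RoundsAtMost R → c / ε ≤ (R : ℝ)) := by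
  refine ⟨(1 - δ) / 8, by linarith, fun C => ?_⟩
  obtain ⟨n₀, hn₀⟩ := exists_forall_le_rounds δ hδ₁ C
  refine ⟨n₀, ?_⟩
  rintro _ k hn hk ⟨m, rfl⟩ hkC ε hε S hS
  obtain ⟨hm, hrounds⟩ := hn₀ k m hn hk hkC
  have hrand : ∀ P : RandomizedAMPCAlgorithm (PotentialEdge (k * m))
      (oneVsKCycleDomain (k * m) k) S,
      P.ComputesWithError (oneVsKCycle (k * m) k) (1 / 6) →
      ∀ R : ℕ, P.RoundsAtMost R → (1 - δ) / 8 / ε ≤ (R : ℝ) := fun P hP R hR =>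
    hrounds ε hε S R hS (P.two_mul_le_of_computesWithError hk hm hP hR)
  -- A deterministic algorithm is a point mass, with success probability 1.
  refine ⟨fun A hA => hrand (PMF.pure A) (fun x => ?_) A.rounds (fun B hB => ?_), hrand⟩
  · rw [PMF.toOuterMeasure_pure_apply, if_pos (by exact hA x)]
    exact ENNReal.ofReal_le_one.2 (by norm_num)
  · rw [PMF.mem_support_pure_iff] at hB
    rw [hB]
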